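/- Let $k\ge 2$. A $k$-graph $H$ consists of a finite vertex set $V(H)$ and a set $E(H)$ of $k$-element subsets of $V(H)$; write $v(H)=|V(H)|$ and let $\delta_1(H)$ be the minimum, over all vertices $x$, of the number of edges containing $x$. A $k$-graph $F$ is $k$-partite if $V(F)$ can be partitioned into $k$ nonempty classes $V_1,\dots,V_k$ such that $|e\cap V_i|=1$ for all $e\in E(F)$ and all $i$. An $F$-factor in $H$ is a set of pairwise vertex-disjoint (not necessarily induced) copies of $F$ in $H$ that together cover $V(H)$. For reals $p\in[0,1]$ and $\mu>0$, a $k$-graph $H=(V,E)$ on $n$ vertices is edge-$(p,\mu)$-dense if for all $X\subseteq V$ and all $Y\subseteq V^{k-1}$, the number of pairs $(x,(y_1,\dots,y_{k-1}))\in X\times Y$ with $\{x,y_1,\dots,y_{k-1}\}\in E$ is at least $p|X||Y|-\mu n^k$. **Theorem.** Let $k\ge2$ and let $F$ be a $k$-partite $k$-graph. Then $F\in\mathbf{FACTOR}_k^{\mathrm{edge},1}$, that is: for all $0<p,\alpha<1$ there exist $n_0\in\mathbb N$ and $\mu>0$ such that every edge-$(p,\mu)$-dense $k$-graph $H$ on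 $n\ge n_0$ vertices with $\delta_1(H)\ge\alpha n^{k-1}$ and $v(F)\mid n$ has an $F$-factor. -/

import Mathlib

universe u v

/-- A `k`-graph (`k`-uniform hypergraph) whose vertex set is the type `V`: a set of `k`-element
subsets of `V`. It is always used with `V` finite. -/
structure KGraph (k : ℕ) (V : Type u) where
  /-- The edges. -/
  edges : Finset (Finset V)
  /-- Every edge has exactly `k` vertices. -/
  card_eq : ∀ e ∈ edges, e.card = k

namespace KGraph

/-- A partition of the vertex set into `k` nonempty classes, the `i`-th one being
`{w | c w = i}`, is a `k`-partite realisation if each edge meets each class in exactly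
one vertex. -/
def IsPartiteRealisation {k : ℕ} {W : Type u} (F : KGraph k W) (c : W → Fin k) : Prop :=
  Function.Surjective c ∧ ∀ e ∈ F.edges, ∀ i : Fin k, (e.filter (fun w => c w = i)).card = 1

/-- `F` is `k`-partite if it admits a `k`-partite realisation. -/
def IsKPartite {k : ℕ} {W : Type u} (F : KGraph k W) : Prop :=
  ∃ c : W → Fin k, F.IsPartiteRealisation c

/-- The number of edges that contain the vertex set `S`. -/
def deg {k : ℕ} {V : Type u} [DecidableEq V] (H : KGraph k V) (S : Finset V) : ℕ :=
  (H.edges.filter (fun e => S ⊆ e)).card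

/-- The minimum `s`-degree: the minimum of `deg S` over all `s`-element vertex sets `S`. -/
noncomputable def minDegree {k : ℕ} {V : Type u} [DecidableEq V] (H : KGraph k V) (s : ℕ) : ℕ :=
  sInf {d : ℕ | ∃ S : Finset V, S.card = s ∧ H.deg S = d}

theorem minDegree_le_deg {k : ℕ} {V : Type u} [DecidableEq V] (H : KGraph k V) (S : Finset V) :
    H.minDegree S.card ≤ H.deg S :=
  Nat.sInf_le ⟨S, rfl, rfl⟩

/-- On at least `s` vertices the minimum in the minimum `s`-degree is attained. -/
theorem exists_deg_eq_minDegree {k : ℕ} {V : Type u} [Fintype V] [DecidableEq V]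
    (H : KGraph k V) (s : ℕ) (hs : s ≤ Fintype.card V) :
    ∃ S : Finset V, S.card = s ∧ H.deg S = H.minDegree s := by
  obtain ⟨S, -, hS⟩ := Finset.exists_subset_card_eq (s := (Finset.univ : Finset V)) hs
  exact Nat.sInf_mem (s := {d : ℕ | ∃ S : Finset V, S.card = s ∧ H.deg S = d}) ⟨_, S, hS, rfl⟩

/-- The number of pairs `(x, (y₁, …, yₖ₋₁)) ∈ X × Y` such that `{x, y₁, …, yₖ₋₁}` is an edge,
for a set `X` of vertices and a set `Y` of ordered `(k-1)`-tuples of vertices. -/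
def edgeCount {k : ℕ} {V : Type u} [DecidableEq V] (H : KGraph k V)
    (X : Finset V) (Y : Finset (Fin (k - 1) → V)) : ℕ :=
  ((X ×ˢ Y).filter (fun q => insert q.1 (Finset.univ.image q.2) ∈ H.edges)).card

/-- `H` is edge-quasi-random with parameters `p` and `μ`: for every set `X` of vertices and every
set `Y` of `(k-1)`-tuples of vertices, `e(X, Y) ≥ p |X| |Y| - μ nᵏ`, with `n` the number of
vertices. -/
def IsEdgeDense {k : ℕ} {V : Type u} [Fintype V] [DecidableEq V] (H : KGraph k V)
    (p μ : ℝ) : Prop :=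
  ∀ (X : Finset V) (Y : Finset (Fin (k - 1) → V)),
    (H.edgeCount X Y : ℝ) ≥ p * (X.card : ℝ) * (Y.card : ℝ) - μ * (Fintype.card V : ℝ) ^ k

/-- A copy of `F` in `H` (not necessarily induced): an injective map of the vertices of `F` to
those of `H` that takes edges to edges. -/
structure Copy {k : ℕ} {W : Type u} {V : Type v} (F : KGraph k W) (H : KGraph k V) where
  /-- The map on vertices. -/
  toEmbedding : W ↪ V
  /-- Edges go to edges. -/
  map_edge : ∀ e ∈ F.edges, e.map toEmbedding ∈ H.edges

/-- The set of vertices of `H` that a copy of `F` covers. -/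
def Copy.verts {k : ℕ} {W : Type u} {V : Type v} {F : KGraph k W} {H : KGraph k V}
    (φ : Copy F H) : Set V :=
  Set.range φ.toEmbedding

/-- `H` has an `F`-factor: a set of pairwise vertex-disjoint copies of `F` that together cover
all vertices of `H`. -/
def HasFactor {k : ℕ} {W : Type u} {V : Type v} (F : KGraph k W) (H : KGraph k V) : Prop :=
  ∃ T : Set (Copy F H), T.PairwiseDisjoint Copy.verts ∧ ⋃ φ ∈ T, φ.verts = Set.univ

/-- Membership of `F` in the class `FACTOR` for edge-quasi-randomness, uniformity `k` and minimum
`s`-degree (`1 ≤ s ≤ k - 1`). -/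
def InFactorEdge {k : ℕ} {W : Type u} [Fintype W] (F : KGraph k W) (s : ℕ) : Prop :=
  ∀ p α : ℝ, 0 < p → p < 1 → 0 < α → α < 1 →
    ∃ (n₀ : ℕ) (μ : ℝ), 0 < μ ∧
      ∀ (V : Type v) [Fintype V] [DecidableEq V] (H : KGraph k V),
        H.IsEdgeDense p μ →
        (H.minDegree s : ℝ) ≥ α * (Fintype.card V : ℝ) ^ (k - s) →
        n₀ ≤ Fintype.card V →
        Fintype.card W ∣ Fintype.card V →
        F.HasFactor H

end KGraph

/-! The proof is by absorption. `F` lies inside the complete `k`-partite `k`-graph on the fibres of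
its colouring `c`, so copies come from supersaturation: a positive density of ordered edges yields a
positive density of homomorphisms (`card_transversalHoms_ge`), most of them injective when `n` is
large. Edge density supplies such edges inside every vertex set of linear size, so greedy tiling
leaves only a small set uncovered.

Absorption rests on switching. Edge density tested against the link of a vertex `r`, which is large
by the degree condition, shows that all but few vertices `u` share a positive proportion of that
link (`card_farVertices_le`). Tested against the common link of `u` and `r`, it gives many maps that
become homomorphisms with either `u` or `r` at a fixed vertex `w₀` (`card_switches_ge`). An absorber
for a tuple `r` is a copy `u` of `F` together with one switch between `u w` and `r w` for each `w`.
If `r` is absent, the switches cover the vertices `u w`; if it is present, they cover the `r w` and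
`u` is a copy by itself.

Absorbers for each `r` have positive density among all tuples. A weight argument in place of random
selection (`exists_disjoint_family`) finds linearly many disjoint absorbers, with linearly many for
each `r`. The remainder of the greedy tiling has size divisible by `v(F)` and is absorbed one
`v(F)`-set at a time. -/

/-! ### Supersaturation by cloning vertices -/

/-- The maps `φ : W → V` sending every section of the colouring `c : W → ι` into `E`: homomorphisms
from the complete `ι`-partite hypergraph with classes the fibres of `c`. -/
noncomputable def transversalHoms {ι W V : Type*} [Fintype W] [Fintype V] (c : W → ι)
    (E : Finset (ι → V)) : Finset (W → V) :=
  by classical exact Finset.univ.filter (fun φ => ∀ s : ι → W, (∀ i, c (s i) = i) → φ ∘ s ∈ E)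

theorem mem_transversalHoms {ι W V : Type*} [Fintype W] [Fintype V] {c : W → ι}
    {E : Finset (ι → V)} {φ : W → V} :
    φ ∈ transversalHoms c E ↔ ∀ s : ι → W, (∀ i, c (s i) = i) → φ ∘ s ∈ E := by
  classical
  simp [transversalHoms]

theorem transversalHoms_mono {ι W V : Type*} [Fintype W] [Fintype V] {c : W → ι}
    {E E' : Finset (ι → V)} (h : E ⊆ E') : transversalHoms c E ⊆ transversalHoms c E' :=
  fun _ hφ => mem_transversalHoms.2 fun s hs => h (mem_transversalHoms.1 hφ s hs)

/-- Cauchy–Schwarz over the restrictions to `W \ {w}`: the sum of the squared fibre sizes counts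
pairs of maps in `S` that agree off `w`. -/
theorem sq_card_le_card_clone {W V : Type*} [Fintype W] [Fintype V] [DecidableEq W]
    [DecidableEq V] (S : Finset (W → V)) (w : W) :
    S.card ^ 2 ≤ Fintype.card V ^ (Fintype.card W - 1) *
      ((Finset.univ ×ˢ S).filter (fun q : V × (W → V) => Function.update q.2 w q.1 ∈ S)).card := by
  set r : (W → V) → ({x // x ≠ w} → V) := fun φ x => φ x with hr
  have hcard : Fintype.card ({x // x ≠ w} → V) = Fintype.card V ^ (Fintype.card W - 1) := by
    simp [Fintype.card_subtype_compl]
  have hS : S.card = ∑ y : ({x // x ≠ w} → V), (S.filter (fun φ => r φ = y)).card :=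
    Finset.card_eq_sum_card_fiberwise (fun _ _ => Finset.mem_univ _)
  have hC := sq_sum_le_card_mul_sum_sq (s := (Finset.univ : Finset ({x // x ≠ w} → V)))
    (f := fun y => (S.filter (fun φ => r φ = y)).card)
  rw [← hS, Finset.card_univ, hcard] at hC
  refine hC.trans (Nat.mul_le_mul_left _ ?_)
  rw [Finset.card_eq_sum_card_fiberwise
    (f := fun q : V × (W → V) => r q.2) (t := Finset.univ) (fun _ _ => Finset.mem_univ _)]
  refine Finset.sum_le_sum fun y _ => ?_
  rw [sq, ← Finset.card_product]
  refine Finset.card_le_card_of_injOn (fun q => (q.1 w, q.2)) ?_ ?_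
  · rintro ⟨a, b⟩ h
    simp only [Finset.coe_product, Set.mem_prod, Finset.mem_coe, Finset.mem_filter] at h
    obtain ⟨⟨ha, ha'⟩, hb, hb'⟩ := h
    have : Function.update b w (a w) = a := by
      funext x
      by_cases hx : x = w
      · subst hx; simp
      · rw [Function.update_of_ne hx]
        exact congrFun (hb'.trans ha'.symm) ⟨x, hx⟩
    simp [this, ha, hb, hb']
  · rintro ⟨a, b⟩ h ⟨a', b'⟩ h' heq
    simp only [Finset.coe_product, Set.mem_prod, Finset.mem_coe, Finset.mem_filter] at h h'
    simp only [Prod.mk.injEq] at heq ⊢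
    refine ⟨?_, heq.2⟩
    funext x
    by_cases hx : x = w
    · subst hx; exact heq.1
    · exact congrFun (h.1.2.trans h'.1.2.symm) ⟨x, hx⟩

/-- A homomorphism on `W \ {w}` with a second admissible image for the twin `w'` extends by giving
that image to `w`. A section contains at most one of `w`, `w'`, so a section through `w` can be
rerouted through `w'`. -/
theorem card_clone_le_card_transversalHoms {ι W V : Type*} [Fintype W] [Fintype V]
    [DecidableEq ι] [DecidableEq W] [DecidableEq V] (c : W → ι) (E : Finset (ι → V)) {w w' : W}
    (hne : w' ≠ w) (hc : c w = c w') :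
    ((Finset.univ ×ˢ transversalHoms (fun x : {x // x ≠ w} => c x) E).filter
      (fun q : V × ({x // x ≠ w} → V) => Function.update q.2 ⟨w', hne⟩ q.1 ∈
        transversalHoms (fun x : {x // x ≠ w} => c x) E)).card ≤ (transversalHoms c E).card := by
  refine Finset.card_le_card_of_injOn
    (fun q x => if h : x = w then q.1 else q.2 ⟨x, h⟩) ?_ ?_
  · rintro ⟨b, ψ⟩ h
    simp only [Finset.coe_filter, Finset.mem_product, Finset.mem_univ, true_and,
      Set.mem_ofPred_eq] at h
    obtain ⟨h1, h2⟩ := h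
    rw [mem_transversalHoms] at h1 h2
    refine mem_transversalHoms.2 fun s hs => ?_
    by_cases hw : s (c w) = w
    · have hsn : ∀ i, i ≠ c w → s i ≠ w := fun i hi h => hi (by rw [← hs i, h])
      have := h2 (fun i => if hi : i = c w then ⟨w', hne⟩ else ⟨s i, hsn i hi⟩) (by
        intro i
        by_cases hi : i = c w
        · simp [hi, hc]
        · simp [hi, hs])
      convert this using 1
      funext i
      by_cases hi : i = c w
      · subst hi; simp [hw]
      · have hne' : s i ≠ w' := fun h => hi (by rw [← hs i, h, hc])
        simp [hi, hsn i hi, Function.update_of_ne, hne']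
    · have hsn : ∀ i, s i ≠ w := by
        intro i h
        have : i = c w := by rw [← hs i, h]
        exact hw (this ▸ h)
      have := h1 (fun i => ⟨s i, hsn i⟩) hs
      convert this using 1
      funext i
      simp [hsn i]
  · rintro ⟨b, ψ⟩ - ⟨b', ψ'⟩ - heq
    simp only [Prod.mk.injEq]
    refine ⟨by simpa using congrFun heq w, ?_⟩
    funext x
    simpa [x.2] using congrFun heq x

/-- Supersaturation for complete `ι`-partite hypergraphs. -/
theorem card_transversalHoms_ge {ι V : Type*} [Fintype ι] [Fintype V] [Nonempty V]
    (E : Finset (ι → V)) {d : ℝ} (hd : 0 ≤ d)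
    (hE : d * (Fintype.card V : ℝ) ^ Fintype.card ι ≤ E.card) (m : ℕ) :
    ∀ {W : Type u} [Fintype W] (c : W → ι), Function.Surjective c →
      Fintype.card W = Fintype.card ι + m →
      d ^ 2 ^ m * (Fintype.card V : ℝ) ^ Fintype.card W ≤ (transversalHoms c E).card := by
  classical
  induction m with
  | zero =>
    intro W _ c hc hW
    simp only [add_zero] at hW
    rw [hW, pow_zero, pow_one]
    refine hE.trans ?_
    norm_cast
    refine Finset.card_le_card_of_injOn (fun t => t ∘ c) ?_ ?_
    · intro t ht
      refine mem_transversalHoms.2 fun s hs => ?_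
      have : (t ∘ c) ∘ s = t := by funext i; simp [hs]
      rwa [this]
    · intro t _ t' _ h
      exact hc.injective_comp_right h
  | succ m ih =>
    intro W _ c hc hW
    -- With more vertices than classes, two share a class. Deleting one and cloning the other
    -- squares the density, hence the exponent `2 ^ m`.
    have hinj : ¬ Function.Injective c := fun h => by
      have := Fintype.card_le_of_injective c h
      omega
    obtain ⟨w, w', hcc, hne⟩ : ∃ w w', c w = c w' ∧ w' ≠ w := by
      simp only [Function.Injective, not_forall] at hinj
      obtain ⟨a, b, h, hn⟩ := hinj
      exact ⟨a, b, h, fun h => hn h.symm⟩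
    have hW' : Fintype.card {x // x ≠ w} = Fintype.card ι + m := by
      simp [Fintype.card_subtype_compl]; omega
    have hc' : Function.Surjective (fun x : {x // x ≠ w} => c x) := by
      intro i
      obtain ⟨x, rfl⟩ := hc i
      by_cases hx : x = w
      · exact ⟨⟨w', hne⟩, by simp [hx, hcc]⟩
      · exact ⟨⟨x, hx⟩, rfl⟩
    have h1 := ih (fun x : {x // x ≠ w} => c x) hc' hW'
    have h2 := sq_card_le_card_clone (transversalHoms (fun x : {x // x ≠ w} => c x) E) ⟨w', hne⟩
    have h3 := card_clone_le_card_transversalHoms c E hne hcc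
    have h4 := h2.trans (Nat.mul_le_mul_left _ h3)
    have hpos : 0 < Fintype.card {x // x ≠ w} := Fintype.card_pos_iff.2 ⟨⟨w', hne⟩⟩
    have hW2 : Fintype.card W = Fintype.card {x // x ≠ w} + 1 := by omega
    obtain ⟨l, hl⟩ : ∃ l, Fintype.card {x // x ≠ w} = l + 1 := ⟨_, (Nat.succ_pred_eq_of_pos hpos).symm⟩
    rw [hl] at h1 h4 hW2
    have hn : (0 : ℝ) < Fintype.card V := by exact_mod_cast Fintype.card_pos
    have h5 : ((transversalHoms (fun x : {x // x ≠ w} => c x) E).card : ℝ) ^ 2 ≤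
        (Fintype.card V : ℝ) ^ l * (transversalHoms c E).card := by exact_mod_cast h4
    have h6 := pow_le_pow_left₀ (by positivity) h1 2
    have h7 := h6.trans h5
    have hnl : (0 : ℝ) < (Fintype.card V : ℝ) ^ l := by positivity
    refine le_of_mul_le_mul_left ?_ hnl
    refine le_trans (le_of_eq ?_) h7
    rw [hW2]
    ring

/-! ### Union bounds for degenerate tuples -/

/-- For fixed `a ≠ b`, a tuple with `T a = T b` can be recovered after its entry at `a` is
overwritten by any vertex, so such tuples make up at most a `1 / |V|` fraction. Multiplying by `|V|`
avoids a subtracted exponent. -/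
theorem card_filter_not_injective_le (J V : Type*) [Fintype J] [Fintype V] [DecidableEq J]
    [DecidableEq V] [DecidablePred (fun T : J → V => ¬ Function.Injective T)] :
    (Finset.univ.filter (fun T : J → V => ¬ Function.Injective T)).card * Fintype.card V ≤
      Fintype.card J ^ 2 * Fintype.card V ^ Fintype.card J := by
  have hsub : Finset.univ.filter (fun T : J → V => ¬ Function.Injective T) ⊆
      (Finset.univ : Finset (J × J)).biUnion (fun q => Finset.univ.filter
        (fun T : J → V => q.1 ≠ q.2 ∧ T q.1 = T q.2)) := by
    intro T hT
    simp only [Finset.mem_filter, Finset.mem_univ, true_and, Function.Injective,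
      not_forall] at hT
    obtain ⟨a, b, h, hn⟩ := hT
    simp only [Finset.mem_biUnion, Finset.mem_univ, true_and, Finset.mem_filter]
    exact ⟨(a, b), hn, h⟩
  have hone : ∀ q : J × J, (Finset.univ.filter
      (fun T : J → V => q.1 ≠ q.2 ∧ T q.1 = T q.2)).card * Fintype.card V ≤
      Fintype.card V ^ Fintype.card J := by
    rintro ⟨a, b⟩
    rw [← Fintype.card_fun, ← Finset.card_univ (α := V), ← Finset.card_product,
      ← Finset.card_univ (α := J → V)]
    refine Finset.card_le_card_of_injOn (fun z => Function.update z.1 a z.2)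
      (fun _ _ => Finset.mem_coe.2 (Finset.mem_univ _)) ?_
    rintro ⟨T, x⟩ h ⟨T', x'⟩ h' heq
    simp only [Finset.coe_product, Set.mem_prod, Finset.mem_coe, Finset.mem_filter,
      Finset.mem_univ, true_and, and_true] at h h' heq
    have hx : x = x' := by simpa using congrFun heq a
    have hT : ∀ y, y ≠ a → T y = T' y := fun y hy => by
      simpa [Function.update_of_ne hy] using congrFun heq y
    refine Prod.ext (funext fun y => ?_) hx
    by_cases hy : y = a
    · subst hy
      change T y = T' y
      rw [h.2, h'.2, hT b (Ne.symm h.1)]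
    · exact hT y hy
  calc _ ≤ (∑ q : J × J, (Finset.univ.filter
      (fun T : J → V => q.1 ≠ q.2 ∧ T q.1 = T q.2)).card) * Fintype.card V :=
        Nat.mul_le_mul_right _ ((Finset.card_le_card hsub).trans Finset.card_biUnion_le)
    _ = ∑ q : J × J, (Finset.univ.filter
      (fun T : J → V => q.1 ≠ q.2 ∧ T q.1 = T q.2)).card * Fintype.card V := Finset.sum_mul _ _ _
    _ ≤ ∑ q : J × J, Fintype.card V ^ Fintype.card J := Finset.sum_le_sum fun q _ => hone q
    _ = _ := by simp [sq]

theorem card_filter_apply_mem_le {J V : Type*} [Fintype J] [Fintype V] [DecidableEq J]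
    [DecidableEq V] (B : J → Finset V) :
    (Finset.univ.filter (fun T : J → V => ∃ j, T j ∈ B j)).card * Fintype.card V ≤
      (∑ j, (B j).card) * Fintype.card V ^ Fintype.card J := by
  have hsub : Finset.univ.filter (fun T : J → V => ∃ j, T j ∈ B j) ⊆
      (Finset.univ : Finset J).biUnion (fun j => Finset.univ.filter
        (fun T : J → V => T j ∈ B j)) := by
    intro T hT
    simpa using hT
  have hone : ∀ j : J, (Finset.univ.filter (fun T : J → V => T j ∈ B j)).card * Fintype.card V ≤
      (B j).card * Fintype.card V ^ Fintype.card J := by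
    intro j
    rw [← Fintype.card_fun, ← Finset.card_univ (α := V), ← Finset.card_product,
      ← Finset.card_univ (α := J → V), ← Finset.card_product]
    refine Finset.card_le_card_of_injOn (fun z => (z.1 j, Function.update z.1 j z.2)) ?_ ?_
    · rintro ⟨T, x⟩ h
      simpa using h
    · rintro ⟨T, x⟩ h ⟨T', x'⟩ h' heq
      simp only [Prod.mk.injEq] at heq
      have hx : x = x' := by simpa using congrFun heq.2 j
      refine Prod.ext (funext fun y => ?_) hx
      by_cases hy : y = j
      · subst hy; exact heq.1
      · simpa [Function.update_of_ne hy] using congrFun heq.2 y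
  calc _ ≤ (∑ j : J, (Finset.univ.filter (fun T : J → V => T j ∈ B j)).card) * Fintype.card V :=
        Nat.mul_le_mul_right _ ((Finset.card_le_card hsub).trans Finset.card_biUnion_le)
    _ = ∑ j : J, (Finset.univ.filter (fun T : J → V => T j ∈ B j)).card * Fintype.card V :=
        Finset.sum_mul _ _ _
    _ ≤ ∑ j : J, (B j).card * Fintype.card V ^ Fintype.card J := Finset.sum_le_sum fun q _ => hone q
    _ = _ := (Finset.sum_mul _ _ _).symm

/-! ### Tilings, greedy covering and absorption -/

namespace KGraph

/-- `S` is the vertex set of a family of pairwise disjoint copies of `F` in `H`. -/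
inductive Tileable {k : ℕ} {W : Type u} {V : Type v} [Fintype W] [DecidableEq V]
    (F : KGraph k W) (H : KGraph k V) : Finset V → Prop
  | empty : Tileable F H ∅
  | add (S : Finset V) (φ : Copy F H) :
      Tileable F H S → Disjoint S (Finset.univ.map φ.toEmbedding) →
      Tileable F H (S ∪ Finset.univ.map φ.toEmbedding)

section Tileable

variable {k : ℕ} {W : Type u} {V : Type v} [Fintype W] [DecidableEq V]
  {F : KGraph k W} {H : KGraph k V}

theorem Tileable.union {S T : Finset V} (hS : F.Tileable H S) (hT : F.Tileable H T)
    (hST : Disjoint S T) : F.Tileable H (S ∪ T) := by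
  induction hT with
  | empty => simpa using hS
  | add T φ hT hd ih =>
    rw [Finset.disjoint_union_right] at hST
    rw [← Finset.union_assoc]
    exact Tileable.add _ φ (ih hST.1) (Finset.disjoint_union_left.2 ⟨hST.2, hd⟩)

theorem tileable_copy (φ : Copy F H) : F.Tileable H (Finset.univ.map φ.toEmbedding) := by
  simpa using Tileable.add ∅ φ Tileable.empty (Finset.disjoint_empty_left _)

theorem Tileable.dvd_card {S : Finset V} (hS : F.Tileable H S) : Fintype.card W ∣ S.card := by
  induction hS with
  | empty => simp
  | add S φ hS hd ih =>
    rw [Finset.card_union_of_disjoint hd, Finset.card_map, Finset.card_univ]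
    exact Dvd.dvd.add ih (dvd_refl _)

theorem Tileable.exists_copies {S : Finset V} (hS : F.Tileable H S) :
    ∃ T : Set (Copy F H), T.PairwiseDisjoint Copy.verts ∧ ⋃ φ ∈ T, φ.verts = (S : Set V) := by
  induction hS with
  | empty => exact ⟨∅, by simp, by simp⟩
  | add S φ hS hd ih =>
    obtain ⟨T, hT, hU⟩ := ih
    have hv : φ.verts = ((Finset.univ.map φ.toEmbedding : Finset V) : Set V) := by
      simp [Copy.verts]
    refine ⟨insert φ T, hT.insert fun ψ hψ _ => ?_, ?_⟩
    · rw [hv]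
      refine Disjoint.mono_right ?_ (Finset.disjoint_coe.2 hd.symm)
      rw [← hU]
      exact Set.subset_biUnion_of_mem (u := fun φ : Copy F H => φ.verts) hψ
    · rw [Set.biUnion_insert, hU, hv, Finset.coe_union, Set.union_comm]

theorem Tileable.hasFactor [Fintype V] (h : F.Tileable H Finset.univ) : F.HasFactor H := by
  simpa [HasFactor] using h.exists_copies

theorem tileable_biUnion {α : Type*} (s : Finset α) (f : α → Finset V)
    (hf : ∀ a ∈ s, F.Tileable H (f a)) (hd : (s : Set α).PairwiseDisjoint f) :
    F.Tileable H (s.biUnion f) := by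
  classical
  induction s using Finset.induction_on with
  | empty => simpa using Tileable.empty
  | insert a s ha ih =>
    rw [Finset.biUnion_insert]
    refine (hf a (by simp)).union
      (ih (fun b hb => hf b (by simp [hb])) (hd.subset (by simp))) ?_
    rw [Finset.disjoint_biUnion_right]
    intro b hb
    exact hd (by simp) (by simp [hb]) (by rintro rfl; exact ha hb)

/-- Greedy tiling. -/
theorem exists_tileable_sdiff {b : ℝ} (hW : 0 < Fintype.card W)
    (h : ∀ U : Finset V, b ≤ U.card → ∃ φ : Copy F H, Finset.univ.map φ.toEmbedding ⊆ U)
    (U : Finset V) :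
    ∃ R ⊆ U, (R.card : ℝ) < b + 1 ∧ F.Tileable H (U \ R) := by
  induction U using Finset.strongInduction with
  | H U ih =>
    by_cases hU : b ≤ U.card
    · obtain ⟨φ, hφ⟩ := h U hU
      have hne : (Finset.univ.map φ.toEmbedding).Nonempty := by
        rw [← Finset.card_pos, Finset.card_map, Finset.card_univ]; exact hW
      obtain ⟨R, hR, hRb, hT⟩ := ih (U \ Finset.univ.map φ.toEmbedding)
        (Finset.sdiff_ssubset hφ hne)
      refine ⟨R, hR.trans Finset.sdiff_subset, hRb, ?_⟩
      have heq : U \ R = (U \ Finset.univ.map φ.toEmbedding) \ R ∪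
          Finset.univ.map φ.toEmbedding := by
        ext x
        have h1 := @hφ x
        have h2 := @hR x
        simp only [Finset.mem_sdiff, Finset.mem_union] at h1 h2 ⊢
        tauto
      rw [heq]
      refine Tileable.add _ φ hT ?_
      exact Finset.disjoint_of_subset_left Finset.sdiff_subset Finset.sdiff_disjoint
    · exact ⟨U, subset_rfl, by linarith, by simpa using Tileable.empty⟩

/-- An absorbing structure for the vertex sets of size `v(F)`. -/
theorem tileable_union_of_absorbers {Γ : Type*} [DecidableEq Γ] (used : Γ → Finset V)
    (S : (W → V) → Finset Γ)
    (hself : ∀ r, ∀ T ∈ S r, F.Tileable H (used T))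
    (habs : ∀ r : W → V, Function.Injective r → ∀ T ∈ S r,
      Disjoint (used T) (Finset.univ.image r) → F.Tileable H (used T ∪ Finset.univ.image r))
    (q : ℕ) : ∀ (R : Finset V) (𝓕 : Finset Γ), R.card = Fintype.card W * q →
      (∀ T ∈ 𝓕, ∃ r, T ∈ S r) →
      (𝓕 : Set Γ).PairwiseDisjoint used → (∀ T ∈ 𝓕, Disjoint (used T) R) →
      (∀ r, q ≤ (𝓕.filter (fun T => T ∈ S r)).card) →
      F.Tileable H (𝓕.biUnion used ∪ R) := by
  induction q with
  | zero =>
    intro R 𝓕 hR hF hd _ _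
    have : R = ∅ := by simpa using hR
    subst this
    rw [Finset.union_empty]
    exact tileable_biUnion _ _ (fun T hT => (hF T hT).elim fun r hr => hself r T hr) hd
  | succ q ih =>
    intro R 𝓕 hR hF hd hdR hq
    obtain ⟨R₁, hR₁, hc⟩ := Finset.exists_subset_card_eq (s := R) (n := Fintype.card W)
      (by rw [hR]; exact Nat.le_mul_of_pos_right _ (Nat.succ_pos q))
    let e : W ≃ R₁ := Fintype.equivOfCardEq (by simp [hc])
    let r : W → V := fun w => e w
    have hrinj : Function.Injective r := Subtype.val_injective.comp e.injective
    have hrim : Finset.univ.image r = R₁ := by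
      ext x
      simp only [Finset.mem_image, Finset.mem_univ, true_and, r]
      constructor
      · rintro ⟨w, rfl⟩; exact (e w).2
      · intro hx; exact ⟨e.symm ⟨x, hx⟩, by simp⟩
    -- One absorber is spent on the block `R₁`. Erasing it costs every other tuple at most one
    -- absorber, so `q` absorbers each suffice for `q` blocks.
    obtain ⟨T, hT⟩ := Finset.card_pos.1 (lt_of_lt_of_le (Nat.succ_pos q) (hq r))
    rw [Finset.mem_filter] at hT
    have h1 : F.Tileable H (used T ∪ R₁) := by
      rw [← hrim]
      refine habs r hrinj T hT.2 ?_
      rw [hrim]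
      exact Finset.disjoint_of_subset_right hR₁ (hdR T hT.1)
    have h2 := ih (R \ R₁) (𝓕.erase T)
      (by rw [Finset.card_sdiff_of_subset hR₁, hR, hc, Nat.mul_succ, Nat.add_sub_cancel])
      (fun T' hT' => hF T' (Finset.mem_of_mem_erase hT'))
      (hd.subset (by simp))
      (fun T' hT' => Finset.disjoint_of_subset_right Finset.sdiff_subset
        (hdR T' (Finset.mem_of_mem_erase hT')))
      (fun r' => by
        rw [Finset.filter_erase]
        have := Finset.pred_card_le_card_erase (s := 𝓕.filter (fun T => T ∈ S r')) (a := T)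
        have := hq r'
        omega)
    have heq : 𝓕.biUnion used ∪ R = ((𝓕.erase T).biUnion used ∪ R \ R₁) ∪ (used T ∪ R₁) := by
      conv_lhs => rw [← Finset.insert_erase hT.1, Finset.biUnion_insert,
        ← Finset.sdiff_union_of_subset hR₁]
      ext x
      simp only [Finset.mem_union]
      tauto
    rw [heq]
    refine h2.union h1 ?_
    rw [Finset.disjoint_union_left, Finset.disjoint_union_right, Finset.disjoint_union_right]
    refine ⟨⟨?_, ?_⟩, ?_, Finset.sdiff_disjoint⟩
    · rw [Finset.disjoint_biUnion_left]
      intro T' hT'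
      rw [Finset.mem_erase] at hT'
      exact hd hT'.2 hT.1 hT'.1
    · rw [Finset.disjoint_biUnion_left]
      intro T' hT'
      exact Finset.disjoint_of_subset_right hR₁ (hdR T' (Finset.mem_of_mem_erase hT'))
    · exact (Finset.disjoint_of_subset_right Finset.sdiff_subset (hdR T hT.1)).symm

end Tileable

end KGraph

/-! ### Selecting disjoint tuples by a weight function -/

/-- One step of the greedy selection of a family of disjoint tuples. -/
theorem exists_disjoint_tuple_mul_sum_le {I J V : Type*} [Fintype I] [Nonempty I] [Fintype J]
    [Fintype V] [DecidableEq V] [DecidableEq J] (S : I → Finset (J → V)) {β : ℝ} (hβ : 0 < β)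
    (hS : ∀ i, β * (Fintype.card V : ℝ) ^ Fintype.card J ≤ (S i).card) (B : Finset V)
    (hB : (Fintype.card J : ℝ) * B.card ≤ β / 2 * Fintype.card V) (hV : 0 < Fintype.card V)
    (a : I → ℝ) (ha : ∀ i, 0 < a i) :
    ∃ T : J → V, (∃ i, T ∈ S i) ∧ (∀ j, T j ∉ B) ∧
      β / 2 * ∑ i, a i ≤ ∑ i, if T ∈ S i then a i else 0 := by
  have hn : (0 : ℝ) < Fintype.card V := by exact_mod_cast hV
  set N : ℝ := (Fintype.card V : ℝ) ^ Fintype.card J with hN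
  have hNpos : 0 < N := by positivity
  set G : Finset (J → V) := Finset.univ.filter (fun T => ∀ j, T j ∉ B) with hG
  -- Avoiding `B` costs at most half the density of each `S i`.
  have hbad : ((Finset.univ.filter (fun T : J → V => ∃ j, T j ∈ B)).card : ℝ) ≤ β / 2 * N := by
    have h1 : ((Finset.univ.filter (fun T : J → V => ∃ j, T j ∈ B)).card : ℝ) *
        Fintype.card V ≤ Fintype.card J * B.card * N := by
      have := card_filter_apply_mem_le (fun _ : J => B)
      simp only [Finset.sum_const, Finset.card_univ, smul_eq_mul] at this
      rw [hN]; exact_mod_cast this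
    refine le_of_mul_le_mul_right (h1.trans ?_) hn
    calc _ ≤ β / 2 * Fintype.card V * N := mul_le_mul_of_nonneg_right hB hNpos.le
      _ = _ := by ring
  have hSG : ∀ i, β / 2 * N ≤ ((S i ∩ G).card : ℝ) := by
    intro i
    have h1 : (S i).card ≤ (S i ∩ G).card +
        (Finset.univ.filter (fun T : J → V => ∃ j, T j ∈ B)).card := by
      refine le_trans (Finset.card_le_card ?_) (Finset.card_union_le _ _)
      intro T hT
      simp only [hG, Finset.mem_union, Finset.mem_inter, hT, Finset.mem_filter, Finset.mem_univ,
        true_and]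
      by_cases h : ∃ j, T j ∈ B
      · exact Or.inr h
      · exact Or.inl (not_exists.1 h)
    have h2 : ((S i).card : ℝ) ≤ (S i ∩ G).card +
        (Finset.univ.filter (fun T : J → V => ∃ j, T j ∈ B)).card := by exact_mod_cast h1
    have h3 := hS i
    linarith
  have hGN : (G.card : ℝ) ≤ N := by
    have : G.card ≤ Fintype.card V ^ Fintype.card J := by
      rw [← Fintype.card_fun, ← Finset.card_univ]
      exact Finset.card_le_card (Finset.subset_univ _)
    rw [hN]; exact_mod_cast this
  have hsum : 0 < ∑ i, a i := Finset.sum_pos (fun i _ => ha i) Finset.univ_nonempty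
  have hGne : G.Nonempty := by
    obtain ⟨i⟩ := ‹Nonempty I›
    have : (0 : ℝ) < (S i ∩ G).card := lt_of_lt_of_le (by positivity) (hSG i)
    exact (Finset.card_pos.1 (by exact_mod_cast this)).mono Finset.inter_subset_right
  -- Averaging over `G`: each `a i` is counted at least `β / 2 * N` times, and `G` has at most `N`
  -- elements.
  obtain ⟨T, hT, hle⟩ := Finset.exists_le_of_sum_le (s := G) hGne
    (f := fun _ => β / 2 * ∑ i, a i) (g := fun T => ∑ i, if T ∈ S i then a i else 0) (by
      rw [Finset.sum_comm, Finset.sum_const, nsmul_eq_mul]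
      have : ∀ i, (∑ T ∈ G, if T ∈ S i then a i else 0) = (S i ∩ G).card * a i := by
        intro i
        rw [← Finset.sum_filter, Finset.sum_const, nsmul_eq_mul, Finset.filter_mem_eq_inter,
          Finset.inter_comm]
      simp only [this]
      calc _ ≤ N * (β / 2 * ∑ i, a i) := mul_le_mul_of_nonneg_right hGN (by positivity)
        _ = ∑ i, β / 2 * N * a i := by rw [← Finset.mul_sum]; ring
        _ ≤ _ := Finset.sum_le_sum fun i _ =>
          mul_le_mul_of_nonneg_right (hSG i) (ha i).le)
  refine ⟨T, ?_, (Finset.mem_filter.1 hT).2, hle⟩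
  by_contra hcon
  push Not at hcon
  simp only [hcon, if_false, Finset.sum_const_zero] at hle
  have : 0 < β / 2 * ∑ i, a i := by positivity
  linarith

/-- Dense sets of tuples admit a common family of disjoint tuples meeting each of them often. -/
theorem exists_disjoint_family {I J V : Type*} [Fintype I] [Nonempty I] [Fintype J] [Nonempty J]
    [Fintype V] [DecidableEq V] [DecidableEq J] (S : I → Finset (J → V)) {β : ℝ} (hβ : 0 < β)
    (hS : ∀ i, β * (Fintype.card V : ℝ) ^ Fintype.card J ≤ (S i).card)
    (hV : 0 < Fintype.card V) (N : ℕ)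
    (hN : (Fintype.card J : ℝ) ^ 2 * N ≤ β / 2 * Fintype.card V) :
    ∃ 𝓕 : Finset (J → V), 𝓕.card = N ∧ (∀ T ∈ 𝓕, ∃ i, T ∈ S i) ∧
      (𝓕 : Set (J → V)).PairwiseDisjoint (fun T => Finset.univ.image T) ∧
      ∑ i, (1 / 2 : ℝ) ^ (𝓕.filter (fun T => T ∈ S i)).card ≤
        Fintype.card I * (1 - β / 4) ^ N := by
  -- The sum is a potential. Adding `T` halves the weight of each `i` with `T ∈ S i`; `T` can be
  -- chosen so that these carry at least a `β / 2` share, so each step gains a factor `1 - β / 4`.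
  induction N with
  | zero => exact ⟨∅, by simp⟩
  | succ N ih =>
    obtain ⟨𝓕, hcard, hmem, hdisj, hpot⟩ := ih (le_trans (by gcongr; simp) hN)
    have hB : (Fintype.card J : ℝ) * (𝓕.biUnion (fun T => Finset.univ.image T)).card ≤
        β / 2 * Fintype.card V := by
      refine le_trans ?_ hN
      have h1 : (𝓕.biUnion (fun T => Finset.univ.image T)).card ≤ N * Fintype.card J := by
        rw [← hcard]
        exact Finset.card_biUnion_le_card_mul _ _ _ fun T _ => Finset.card_image_le
      have h2 : ((𝓕.biUnion (fun T => Finset.univ.image T)).card : ℝ) ≤ N * Fintype.card J := by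
        exact_mod_cast h1
      calc _ ≤ (Fintype.card J : ℝ) * (N * Fintype.card J) := by gcongr
        _ = (Fintype.card J : ℝ) ^ 2 * N := by ring
        _ ≤ _ := by gcongr; simp
    obtain ⟨T, hT, hTB, hle⟩ := exists_disjoint_tuple_mul_sum_le S hβ hS _ hB hV
      (fun i => (1 / 2 : ℝ) ^ (𝓕.filter (fun T => T ∈ S i)).card) (fun i => by positivity)
    have hdT : ∀ T' ∈ 𝓕, Disjoint (Finset.univ.image T) (Finset.univ.image T') := by
      intro T' hT'
      rw [Finset.disjoint_left]
      intro x hx hx'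
      obtain ⟨j, -, rfl⟩ := Finset.mem_image.1 hx
      exact hTB j (Finset.mem_biUnion.2 ⟨T', hT', hx'⟩)
    have hTF : T ∉ 𝓕 := fun h => by
      obtain ⟨j⟩ := ‹Nonempty J›
      exact hTB j (Finset.mem_biUnion.2 ⟨T, h, by simp⟩)
    refine ⟨insert T 𝓕, by simp [hTF, hcard], ?_, ?_, ?_⟩
    · intro T' hT'
      rcases Finset.mem_insert.1 hT' with rfl | h
      · exact hT
      · exact hmem _ h
    · rw [Finset.coe_insert]
      exact hdisj.insert fun T' hT' _ => hdT T' hT'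
    · have : ∀ i, (1 / 2 : ℝ) ^ ((insert T 𝓕).filter (fun T => T ∈ S i)).card =
          (1 / 2 : ℝ) ^ (𝓕.filter (fun T => T ∈ S i)).card - 1 / 2 *
            (if T ∈ S i then (1 / 2 : ℝ) ^ (𝓕.filter (fun T => T ∈ S i)).card else 0) := by
        intro i
        rw [Finset.filter_insert]
        split_ifs with h
        · rw [Finset.card_insert_of_notMem (by simp [hTF]), pow_succ]; ring
        · simp
      simp only [this, Finset.sum_sub_distrib, ← Finset.mul_sum]
      have hβ1 : β ≤ 1 := by
        obtain ⟨i⟩ := ‹Nonempty I›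
        have h1 := hS i
        have h2 : ((S i).card : ℝ) ≤ (Fintype.card V : ℝ) ^ Fintype.card J := by
          have : (S i).card ≤ Fintype.card V ^ Fintype.card J := by
            rw [← Fintype.card_fun, ← Finset.card_univ]
            exact Finset.card_le_card (Finset.subset_univ _)
          exact_mod_cast this
        have hn : (0 : ℝ) < (Fintype.card V : ℝ) ^ Fintype.card J := by positivity
        exact le_of_mul_le_mul_right (by linarith) hn
      have h3 := mul_le_mul_of_nonneg_right hpot (show 0 ≤ 1 - β / 4 by linarith)
      rw [pow_succ, ← mul_assoc]
      refine le_trans ?_ h3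
      nlinarith

/-! ### Consequences of edge density: links, copies, switches -/

namespace KGraph

theorem image_cons {V : Type v} [DecidableEq V] {m : ℕ} (x : V) (y : Fin m → V) :
    Finset.univ.image (Fin.cons x y : Fin (m + 1) → V) = insert x (Finset.univ.image y) := by
  ext z
  simp [Fin.exists_fin_succ, eq_comm]

section Density

variable {V : Type v} [Fintype V] [DecidableEq V]

/-- The ordered edges of `H`. -/
def edgeTuples {k : ℕ} (H : KGraph k V) : Finset (Fin k → V) :=
  Finset.univ.filter (fun t => Finset.univ.image t ∈ H.edges)

/-- The ordered link of the vertex `x`. -/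
def link {m : ℕ} (H : KGraph (m + 1) V) (x : V) : Finset (Fin m → V) :=
  Finset.univ.filter (fun y => insert x (Finset.univ.image y) ∈ H.edges)

/-- The ordered edges with first vertex in `X` and the remaining vertices forming a tuple
of `Y`. -/
def edgeTuplesOn {m : ℕ} (H : KGraph (m + 1) V) (X : Finset V) (Y : Finset (Fin m → V)) :
    Finset (Fin (m + 1) → V) :=
  H.edgeTuples.filter (fun t => t 0 ∈ X ∧ Fin.tail t ∈ Y)

theorem cons_mem_edgeTuples {m : ℕ} {H : KGraph (m + 1) V} {x : V} {y : Fin m → V} :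
    (Fin.cons x y : Fin (m + 1) → V) ∈ H.edgeTuples ↔ y ∈ H.link x := by
  simp [edgeTuples, link, image_cons]

theorem edgeCount_eq_sum {m : ℕ} (H : KGraph (m + 1) V) (X : Finset V)
    (Y : Finset (Fin m → V)) : H.edgeCount X Y = ∑ x ∈ X, (H.link x ∩ Y).card := by
  rw [edgeCount, Finset.card_filter]
  refine (Finset.sum_product X Y _).trans ?_
  refine Finset.sum_congr rfl fun x _ => ?_
  rw [← Finset.card_filter]
  congr 1
  ext y
  simp only [Finset.mem_filter, Finset.mem_inter, link, Finset.mem_univ, true_and]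
  exact and_comm

theorem edgeCount_le_card_edgeTuplesOn {m : ℕ} (H : KGraph (m + 1) V) (X : Finset V)
    (Y : Finset (Fin m → V)) : H.edgeCount X Y ≤ (H.edgeTuplesOn X Y).card := by
  refine Finset.card_le_card_of_injOn
    (fun q : V × (Fin m → V) => (Fin.cons q.1 q.2 : Fin (m + 1) → V)) ?_ ?_
  · rintro ⟨x, y⟩ h
    simp only [Finset.coe_filter, Finset.mem_product, Set.mem_ofPred_eq] at h
    simp only [edgeTuplesOn, Finset.mem_coe, Finset.mem_filter, cons_mem_edgeTuples,
      Fin.cons_zero, Fin.tail_cons, link, Finset.mem_univ, true_and]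
    exact ⟨h.2, h.1⟩
  · rintro ⟨x, y⟩ - ⟨x', y'⟩ - h
    have := Fin.cons_injective2 h
    exact Prod.ext this.1 this.2

/-- Each edge at `x` comes from at least one ordering of its other vertices; the factor `m!` is not
needed. -/
theorem deg_le_card_link {m : ℕ} (H : KGraph (m + 1) V) (x : V) :
    H.deg {x} ≤ (H.link x).card := by
  refine Finset.card_le_card_of_surjOn (fun y => insert x (Finset.univ.image y)) ?_
  intro e he
  simp only [Finset.coe_filter, Finset.singleton_subset_iff, Set.mem_ofPred_eq] at he
  have hc : (e.erase x).card = m := by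
    rw [Finset.card_erase_of_mem he.2, H.card_eq e he.1, Nat.add_sub_cancel]
  have him : Finset.univ.image (fun i => ((Finset.equivFinOfCardEq hc).symm i : V)) =
      e.erase x := by
    ext z
    simp only [Finset.mem_image, Finset.mem_univ, true_and]
    constructor
    · rintro ⟨i, rfl⟩; exact ((Finset.equivFinOfCardEq hc).symm i).2
    · intro hz; exact ⟨Finset.equivFinOfCardEq hc ⟨z, hz⟩, by simp⟩
  refine ⟨fun i => (Finset.equivFinOfCardEq hc).symm i, ?_, ?_⟩
  · simp only [link, Finset.coe_filter, Finset.mem_univ, true_and, Set.mem_ofPred_eq, him,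
      Finset.insert_erase he.2, he.1]
  · simp only [him, Finset.insert_erase he.2]

theorem IsEdgeDense.card_edgeTuplesOn_ge {m : ℕ} {H : KGraph (m + 1) V} {p μ : ℝ}
    (h : H.IsEdgeDense p μ) (X : Finset V) (Y : Finset (Fin m → V)) :
    p * X.card * Y.card - μ * (Fintype.card V : ℝ) ^ (m + 1) ≤ (H.edgeTuplesOn X Y).card := by
  have h1 := h X Y
  have h2 : (H.edgeCount X Y : ℝ) ≤ (H.edgeTuplesOn X Y).card := by
    exact_mod_cast edgeCount_le_card_edgeTuplesOn H X Y
  linarith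

/-- The vertices whose link meets the link of `r` in few tuples. -/
noncomputable def farVertices {m : ℕ} (H : KGraph (m + 1) V) (β : ℝ) (r : V) : Finset V :=
  Finset.univ.filter
    (fun u => ((H.link u ∩ H.link r).card : ℝ) < β * (Fintype.card V : ℝ) ^ m)

/-- Let `X` be the set of far vertices and take `Y` to be the link of `r`. Density forces about `p *
α * |X| * n ^ m` incidences, while farness allows only half of that, so the error term `μ * n ^ (m +
1)` must pay for the other half. -/
theorem IsEdgeDense.card_farVertices_le {m : ℕ} {H : KGraph (m + 1) V} {p μ α ε : ℝ}
    (h : H.IsEdgeDense p μ) (hp : 0 < p) (hα : 0 < α) (hV : 0 < Fintype.card V) {r : V}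
    (hr : α * (Fintype.card V : ℝ) ^ m ≤ (H.link r).card) (hμ : μ ≤ ε * (p * α / 2)) :
    ((H.farVertices (p * α / 2) r).card : ℝ) ≤ ε * Fintype.card V := by
  have hn : (0 : ℝ) < Fintype.card V := by exact_mod_cast hV
  set n : ℝ := ((Fintype.card V : ℕ) : ℝ) with hn_def
  set X := H.farVertices (p * α / 2) r with hX
  have h1 := h X (H.link r)
  rw [edgeCount_eq_sum] at h1
  have h2 : ((∑ x ∈ X, (H.link x ∩ H.link r).card : ℕ) : ℝ) ≤ X.card * (p * α / 2 * n ^ m) := by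
    push_cast
    rw [← nsmul_eq_mul]
    exact Finset.sum_le_card_nsmul _ _ _ fun x hx => (Finset.mem_filter.1 hx).2.le
  have h3 : p * X.card * (α * n ^ m) ≤ p * X.card * (H.link r).card := by gcongr
  have h4 : p * α / 2 * n ^ m * X.card ≤ ε * (p * α / 2) * n ^ (m + 1) := by
    have : μ * n ^ (m + 1) ≤ ε * (p * α / 2) * n ^ (m + 1) := by gcongr
    nlinarith
  have h5 : 0 < p * α / 2 * n ^ m := by positivity
  refine le_of_mul_le_mul_left (h4.trans (le_of_eq ?_)) h5
  ring

end Density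

theorem IsPartiteRealisation.exists_section {W : Type u} {k : ℕ} {F : KGraph k W} {c : W → Fin k}
    (hc : F.IsPartiteRealisation c) {e : Finset W} (he : e ∈ F.edges) :
    ∃ s : Fin k → W, (∀ i, c (s i) = i) ∧ ∀ w, w ∈ e ↔ ∃ i, s i = w := by
  have h := hc.2 e he
  have h1 : ∀ i, ∃ w, e.filter (fun w => c w = i) = {w} := fun i => Finset.card_eq_one.1 (h i)
  choose s hs using h1
  have hm : ∀ i w, (w ∈ e ∧ c w = i) ↔ w = s i := fun i w => by
    have := Finset.ext_iff.1 (hs i) w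
    rwa [Finset.mem_filter, Finset.mem_singleton] at this
  refine ⟨s, fun i => ((hm i (s i)).2 rfl).2, fun w => ⟨fun hw => ⟨c w, ?_⟩, ?_⟩⟩
  · exact ((hm (c w) w).1 ⟨hw, rfl⟩).symm
  · rintro ⟨i, rfl⟩
    exact ((hm i (s i)).2 rfl).1

section Copies

variable {W : Type u} {V : Type v} [Fintype W] [Fintype V] [DecidableEq V]

/-- An injective homomorphism of the complete `k`-partite `k`-graph containing `F` yields a copy
of `F`. -/
def copyOfHom {k : ℕ} {F : KGraph k W} {H : KGraph k V} {c : W → Fin k}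
    (hc : F.IsPartiteRealisation c) {φ : W → V} (hφ : φ ∈ transversalHoms c H.edgeTuples)
    (hinj : Function.Injective φ) : Copy F H where
  toEmbedding := ⟨φ, hinj⟩
  map_edge := by
    intro e he
    obtain ⟨s, hs, hes⟩ := hc.exists_section he
    have h1 := mem_transversalHoms.1 hφ s hs
    have h2 : e.map ⟨φ, hinj⟩ = Finset.univ.image (φ ∘ s) := by
      ext x
      simp only [Finset.mem_map, Function.Embedding.coeFn_mk, Finset.mem_image, Finset.mem_univ,
        true_and, Function.comp_apply, hes]
      constructor
      · rintro ⟨_, ⟨i, rfl⟩, rfl⟩; exact ⟨i, rfl⟩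
      · rintro ⟨i, rfl⟩; exact ⟨_, ⟨i, rfl⟩, rfl⟩
    rw [h2]
    exact (Finset.mem_filter.1 h1).2

theorem map_copyOfHom {k : ℕ} {F : KGraph k W} {H : KGraph k V} {c : W → Fin k}
    (hc : F.IsPartiteRealisation c) {φ : W → V} (hφ : φ ∈ transversalHoms c H.edgeTuples)
    (hinj : Function.Injective φ) :
    Finset.univ.map (copyOfHom hc hφ hinj).toEmbedding = Finset.univ.image φ :=
  Finset.map_eq_image _ _

theorem tileable_image {k : ℕ} {F : KGraph k W} {H : KGraph k V} {c : W → Fin k}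
    (hc : F.IsPartiteRealisation c) {φ : W → V} (hφ : φ ∈ transversalHoms c H.edgeTuples)
    (hinj : Function.Injective φ) : F.Tileable H (Finset.univ.image φ) := by
  rw [← map_copyOfHom hc hφ hinj]
  exact tileable_copy _

/-- A large vertex set of an edge-dense `k`-graph contains a copy of a `k`-partite `k`-graph. -/
theorem IsEdgeDense.exists_copy {m : ℕ} {F : KGraph (m + 1) W} {H : KGraph (m + 1) V}
    {c : W → Fin (m + 1)} (hc : F.IsPartiteRealisation c) {p μ ε : ℝ} (h : H.IsEdgeDense p μ)
    (hp : 0 < p) (hε : 0 < ε) (hμ : μ ≤ p * ε ^ (m + 1) / 2) (hV : 0 < Fintype.card V)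
    (hn : (Fintype.card W : ℝ) ^ 2 <
      (p * ε ^ (m + 1) / 2) ^ 2 ^ (Fintype.card W - (m + 1)) * Fintype.card V)
    (U : Finset V) (hU : ε * Fintype.card V ≤ U.card) :
    ∃ φ : Copy F H, Finset.univ.map φ.toEmbedding ⊆ U := by
  classical
  have hnpos : (0 : ℝ) < Fintype.card V := by exact_mod_cast hV
  have : Nonempty V := Fintype.card_pos_iff.1 hV
  set n : ℝ := ((Fintype.card V : ℕ) : ℝ) with hn_def
  -- Both the first vertex and the tail are confined to `U`; the choice of `μ` leaves half of the
  -- main term `p * |U| ^ (m + 1)`.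
  set E := H.edgeTuplesOn U (Fintype.piFinset fun _ : Fin m => U) with hE
  have hEcard : p * ε ^ (m + 1) / 2 * n ^ Fintype.card (Fin (m + 1)) ≤ E.card := by
    refine le_trans ?_ (h.card_edgeTuplesOn_ge U _)
    rw [Fintype.card_piFinset_const, Fintype.card_fin]
    push_cast
    rw [← hn_def]
    have h1 : (ε * n) ^ (m + 1) ≤ (U.card : ℝ) ^ (m + 1) := by gcongr
    have h2 : μ * n ^ (m + 1) ≤ p * ε ^ (m + 1) / 2 * n ^ (m + 1) := by gcongr
    have h3 := mul_le_mul_of_nonneg_left h1 hp.le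
    rw [mul_pow] at h3
    calc _ = p * (ε ^ (m + 1) * n ^ (m + 1)) - p * ε ^ (m + 1) / 2 * n ^ (m + 1) := by ring
      _ ≤ p * (U.card : ℝ) ^ (m + 1) - μ * n ^ (m + 1) := by linarith
      _ = _ := by ring
  have hWk : m + 1 ≤ Fintype.card W := by
    simpa using Fintype.card_le_of_surjective c hc.1
  have hcount := card_transversalHoms_ge E (by positivity) hEcard
    (Fintype.card W - (m + 1)) c hc.1 (by rw [Fintype.card_fin]; omega)
  obtain ⟨φ, hφ, hinj⟩ : ∃ φ ∈ transversalHoms c E, Function.Injective φ := by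
    by_contra hcon
    push Not at hcon
    have h1 : (transversalHoms c E).card ≤
        (Finset.univ.filter (fun T : W → V => ¬ Function.Injective T)).card :=
      Finset.card_le_card fun φ hφ => by simp [hcon φ hφ]
    have h2 := (Nat.mul_le_mul_right _ h1).trans (card_filter_not_injective_le W V)
    have h3 : ((transversalHoms c E).card : ℝ) * n ≤ (Fintype.card W : ℝ) ^ 2 *
        n ^ Fintype.card W := by rw [hn_def]; exact_mod_cast h2
    have h4 := mul_le_mul_of_nonneg_right hcount hnpos.le
    have h5 : 0 < n ^ Fintype.card W := by positivity
    have h6 := mul_lt_mul_of_pos_right hn h5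
    nlinarith
  have hsub : E ⊆ H.edgeTuples := Finset.filter_subset _ _
  refine ⟨copyOfHom hc (transversalHoms_mono hsub hφ) hinj, ?_⟩
  rw [map_copyOfHom]
  intro x hx
  obtain ⟨w, -, rfl⟩ := Finset.mem_image.1 hx
  obtain ⟨g, hg⟩ := hc.1.hasRightInverse
  -- Every `w` lies on a section of `c`, so `φ w` is a coordinate of an edge inside `U`.
  have hs := mem_transversalHoms.1 hφ (Function.update g (c w) w) (by
    intro i
    by_cases hi : i = c w
    · subst hi; simp
    · simp [Function.update_of_ne hi, hg i])
  have hs2 := (Finset.mem_filter.1 hs).2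
  have hall : ∀ i, (φ ∘ Function.update g (c w) w) i ∈ U := by
    intro i
    refine Fin.cases hs2.1 (fun j => ?_) i
    exact Fintype.mem_piFinset.1 hs2.2 j
  simpa using hall (c w)

/-- If `u` and `r` have many common link tuples, then there are many maps `g` such that both
`g` with `w₀ ↦ u` and `g` with `w₀ ↦ r` are homomorphisms. -/
theorem IsEdgeDense.card_switches_ge {m : ℕ} [DecidableEq W] {H : KGraph (m + 1) V}
    {c : W → Fin (m + 1)} (hc : Function.Surjective c) {w₀ : W} (hw₀ : c w₀ = 0) {p μ β : ℝ}
    (h : H.IsEdgeDense p μ) (hp : 0 < p) (hβ : 0 < β) (hμ : μ ≤ p * β / 2)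
    (hV : 0 < Fintype.card V) {u r : V} (hu : u ∉ H.farVertices β r) :
    (p * β / 2) ^ 2 ^ (Fintype.card W - (m + 1)) * (Fintype.card V : ℝ) ^ Fintype.card W ≤
      (Finset.univ.filter (fun g : W → V =>
        Function.update g w₀ u ∈ transversalHoms c H.edgeTuples ∧
        Function.update g w₀ r ∈ transversalHoms c H.edgeTuples)).card := by
  have hnpos : (0 : ℝ) < Fintype.card V := by exact_mod_cast hV
  have : Nonempty V := Fintype.card_pos_iff.1 hV
  set n : ℝ := ((Fintype.card V : ℕ) : ℝ) with hn_def
  set Y := H.link u ∩ H.link r with hY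
  have hYcard : β * n ^ m ≤ Y.card := by
    simpa [farVertices] using hu
  set E := H.edgeTuplesOn Finset.univ Y with hE
  have hEcard : p * β / 2 * n ^ Fintype.card (Fin (m + 1)) ≤ E.card := by
    refine le_trans ?_ (h.card_edgeTuplesOn_ge Finset.univ Y)
    rw [Fintype.card_fin, Finset.card_univ, ← hn_def]
    have h1 : p * n * (β * n ^ m) ≤ p * n * Y.card := by gcongr
    have h2 : μ * n ^ (m + 1) ≤ p * β / 2 * n ^ (m + 1) := by gcongr
    have h3 : p * n * (β * n ^ m) = p * β * n ^ (m + 1) := by ring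
    linarith
  have hWk : m + 1 ≤ Fintype.card W := by
    simpa using Fintype.card_le_of_surjective c hc
  have hcount := card_transversalHoms_ge E (by positivity) hEcard
    (Fintype.card W - (m + 1)) c hc (by rw [Fintype.card_fin]; omega)
  refine hcount.trans ?_
  norm_cast
  refine Finset.card_le_card fun g hg => ?_
  -- Since `c w₀ = 0`, a section can meet `w₀` only in position `0`, and its tail is then mapped
  -- into `Y`. Hence any `x` whose link contains `Y` may stand at `w₀`.
  have key : ∀ x, Y ⊆ H.link x →
      Function.update g w₀ x ∈ transversalHoms c H.edgeTuples := by
    intro x hx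
    refine mem_transversalHoms.2 fun s hs => ?_
    have hgs := Finset.mem_filter.1 (mem_transversalHoms.1 hg s hs)
    have hne : ∀ i, i ≠ 0 → s i ≠ w₀ := fun i hi h => hi (by rw [← hs i, h, hw₀])
    by_cases h0 : s 0 = w₀
    · have heq : Function.update g w₀ x ∘ s = Fin.cons x (Fin.tail (g ∘ s)) := by
        funext i
        refine Fin.cases ?_ (fun j => ?_) i
        · simp [h0]
        · simp [Fin.tail, Function.update_of_ne (hne j.succ (Fin.succ_ne_zero j))]
      rw [heq, cons_mem_edgeTuples]
      exact hx hgs.2.2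
    · have heq : Function.update g w₀ x ∘ s = g ∘ s := by
        funext i
        by_cases hi : i = 0
        · subst hi; simp [Function.update_of_ne h0]
        · simp [Function.update_of_ne (hne i hi)]
      rw [heq]
      exact hgs.1
  simp only [Finset.mem_filter, Finset.mem_univ, true_and]
  exact ⟨key u Finset.inter_subset_left, key r Finset.inter_subset_right⟩

end Copies

end KGraph

/-! ### Absorbers: the two tilings and the count -/

namespace KGraph

/-- The vertices of a tuple that an absorber uses. -/
def absorberVerts {W : Type u} {V : Type v} [Fintype W] [DecidableEq W] [DecidableEq V]
    (w₀ : W) (T : Option W × W → V) : Finset V :=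
  (Finset.univ.filter (fun j : Option W × W => j.1 = none ∨ j.2 ≠ w₀)).image T

theorem absorberVerts_subset {W : Type u} {V : Type v} [Fintype W] [DecidableEq W]
    [DecidableEq V] (w₀ : W) (T : Option W × W → V) :
    absorberVerts w₀ T ⊆ Finset.univ.image T :=
  Finset.image_subset_image (Finset.subset_univ _)

section Absorbers

variable {W : Type u} {V : Type v} [Fintype W] [DecidableEq W] [Fintype V] [DecidableEq V]

/-- The absorbers for the tuple `r`: a homomorphism `u = T (none, ·)` together with, for each `w`,
a map `T (some w, ·)` that becomes a homomorphism when its value at `w₀` is replaced by either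
`u w` or `r w`. -/
noncomputable def absorbers {k : ℕ} (H : KGraph k V) (c : W → Fin k) (w₀ : W) (r : W → V) :
    Finset (Option W × W → V) :=
  by classical exact Finset.univ.filter (fun T =>
    (fun w => T (none, w)) ∈ transversalHoms c H.edgeTuples ∧
    ∀ w, Function.update (fun w' => T (some w, w')) w₀ (T (none, w)) ∈
        transversalHoms c H.edgeTuples ∧
      Function.update (fun w' => T (some w, w')) w₀ (r w) ∈ transversalHoms c H.edgeTuples)

/-- Each row `some w` takes `T (none, w)` as its value at `w₀`; these copies partition the absorber.
The entry at `(some w, w₀)` is a dummy. -/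
theorem tileable_absorberVerts {k : ℕ} {F : KGraph k W} {H : KGraph k V} {c : W → Fin k}
    (hc : F.IsPartiteRealisation c) {w₀ : W} {r : W → V} {T : Option W × W → V}
    (hT : T ∈ H.absorbers c w₀ r) (hinj : Function.Injective T) :
    F.Tileable H (absorberVerts w₀ T) := by
  simp only [absorbers, Finset.mem_filter, Finset.mem_univ, true_and] at hT
  have hval : ∀ w w', Function.update (fun w' => T (some w, w')) w₀ (T (none, w)) w' =
      T (if w' = w₀ then (none, w) else (some w, w')) := by
    intro w w'
    by_cases h : w' = w₀
    · subst h; simp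
    · simp [h]
  have heq : absorberVerts w₀ T = Finset.univ.biUnion (fun w => Finset.univ.image
      (Function.update (fun w' => T (some w, w')) w₀ (T (none, w)))) := by
    ext x
    simp only [absorberVerts, Finset.mem_image, Finset.mem_filter, Finset.mem_univ, true_and,
      Finset.mem_biUnion, hval]
    constructor
    · rintro ⟨⟨o, w'⟩, h, rfl⟩
      cases o with
      | none => exact ⟨w', w₀, by simp⟩
      | some w => exact ⟨w, w', by simp at h; simp [h]⟩
    · rintro ⟨w, w', rfl⟩
      refine ⟨_, ?_, rfl⟩
      by_cases h : w' = w₀ <;> simp [h]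
  rw [heq]
  refine tileable_biUnion _ _ (fun w _ => tileable_image hc (hT.2 w).1 ?_) ?_
  · intro a b hab
    rw [hval, hval] at hab
    have := hinj hab
    by_cases ha : a = w₀ <;> by_cases hb : b = w₀ <;> simp [ha, hb] at this ⊢
    exact this
  · intro w _ w' _ hne
    rw [Function.onFun, Finset.disjoint_left]
    intro x hx hx'
    simp only [Finset.mem_image, Finset.mem_univ, true_and, hval] at hx hx'
    obtain ⟨a, rfl⟩ := hx
    obtain ⟨b, hb⟩ := hx'
    have := hinj hb
    by_cases ha : a = w₀ <;> by_cases hb : b = w₀ <;> simp [ha, hb] at this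
    · exact hne this.symm
    · exact hne this.1.symm

/-- Now `r w` stands at `w₀` in row `some w`, which frees the row `none` to be a copy by itself. -/
theorem tileable_absorberVerts_union {k : ℕ} {F : KGraph k W} {H : KGraph k V} {c : W → Fin k}
    (hc : F.IsPartiteRealisation c) {w₀ : W} {r : W → V} {T : Option W × W → V}
    (hT : T ∈ H.absorbers c w₀ r) (hinj : Function.Injective T) (hr : Function.Injective r)
    (hd : Disjoint (absorberVerts w₀ T) (Finset.univ.image r)) :
    F.Tileable H (absorberVerts w₀ T ∪ Finset.univ.image r) := by
  simp only [absorbers, Finset.mem_filter, Finset.mem_univ, true_and] at hT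
  have hval : ∀ w w', Function.update (fun w' => T (some w, w')) w₀ (r w) w' =
      if w' = w₀ then r w else T (some w, w') := by
    intro w w'
    by_cases h : w' = w₀
    · subst h; simp
    · simp [h]
  have hd' := Finset.disjoint_left.1 hd
  have hTr : ∀ w w' w'', w' ≠ w₀ → T (some w, w') ≠ r w'' := by
    intro w w' w'' hw' h
    refine @hd' (r w'') ?_ (by simp)
    rw [← h]
    exact Finset.mem_image_of_mem _ (by simp [hw'])
  have hTr' : ∀ w w'', T (none, w) ≠ r w'' := by
    intro w w'' h
    refine @hd' (r w'') ?_ (by simp)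
    rw [← h]
    exact Finset.mem_image_of_mem _ (by simp)
  have heq : absorberVerts w₀ T ∪ Finset.univ.image r = Finset.univ.biUnion (fun w =>
      Finset.univ.image (Function.update (fun w' => T (some w, w')) w₀ (r w))) ∪
      Finset.univ.image (fun w => T (none, w)) := by
    ext x
    simp only [absorberVerts, Finset.mem_image, Finset.mem_filter, Finset.mem_univ, true_and,
      Finset.mem_biUnion, Finset.mem_union, hval]
    constructor
    · rintro (⟨⟨o, w'⟩, h, rfl⟩ | ⟨w, rfl⟩)
      · cases o with
        | none => exact Or.inr ⟨w', rfl⟩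
        | some w => exact Or.inl ⟨w, w', by simp at h; simp [h]⟩
      · exact Or.inl ⟨w, w₀, by simp⟩
    · rintro (⟨w, w', rfl⟩ | ⟨w, rfl⟩)
      · by_cases h : w' = w₀
        · exact Or.inr ⟨w, by simp [h]⟩
        · exact Or.inl ⟨(some w, w'), by simp [h], by simp [h]⟩
      · exact Or.inl ⟨(none, w), by simp, rfl⟩
  rw [heq]
  refine Tileable.union (tileable_biUnion _ _ (fun w _ => tileable_image hc (hT.2 w).2 ?_) ?_)
    (tileable_image hc hT.1 ?_) ?_
  · intro a b hab
    rw [hval, hval] at hab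
    by_cases ha : a = w₀ <;> by_cases hb : b = w₀ <;> simp only [ha, hb, if_true, if_false] at hab ⊢
    · exact absurd hab.symm (hTr _ _ _ hb)
    · exact absurd hab (hTr _ _ _ ha)
    · simpa using hinj hab
  · intro w _ w' _ hne
    rw [Function.onFun, Finset.disjoint_left]
    intro x hx hx'
    simp only [Finset.mem_image, Finset.mem_univ, true_and, hval] at hx hx'
    obtain ⟨a, rfl⟩ := hx
    obtain ⟨b, hab⟩ := hx'
    by_cases ha : a = w₀ <;> by_cases hb : b = w₀ <;> simp only [ha, hb, if_true, if_false] at hab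
    · exact hne (hr hab).symm
    · exact absurd hab (hTr _ _ _ hb)
    · exact absurd hab.symm (hTr _ _ _ ha)
    · have := hinj hab
      simp only [Prod.mk.injEq, Option.some.injEq] at this
      exact hne this.1.symm
  · intro a b hab
    simpa using hinj hab
  · rw [Finset.disjoint_left]
    intro x hx hx'
    simp only [Finset.mem_biUnion, Finset.mem_image, Finset.mem_univ, true_and, hval] at hx hx'
    obtain ⟨w, w', rfl⟩ := hx
    obtain ⟨a, ha⟩ := hx'
    by_cases h : w' = w₀ <;> simp only [h, if_true, if_false] at ha
    · exact hTr' _ _ ha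
    · simpa using hinj ha

/-- Each coordinate has at most `ε * n` far choices, so the union bound removes at most half of the
homomorphisms. -/
theorem card_homs_near_ge {m : ℕ} {H : KGraph (m + 1) V} {c : W → Fin (m + 1)}
    {β a ε : ℝ} (hV : 0 < Fintype.card V) {r : W → V}
    (hhom : a * (Fintype.card V : ℝ) ^ Fintype.card W ≤
      (transversalHoms c H.edgeTuples).card)
    (hfar : ∀ w, ((H.farVertices β (r w)).card : ℝ) ≤ ε * Fintype.card V)
    (hε : Fintype.card W * ε ≤ a / 2) :
    a / 2 * (Fintype.card V : ℝ) ^ Fintype.card W ≤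
      ((transversalHoms c H.edgeTuples).filter
        (fun u => ∀ w, u w ∉ H.farVertices β (r w))).card := by
  have hnpos : (0 : ℝ) < Fintype.card V := by exact_mod_cast hV
  set n : ℝ := ((Fintype.card V : ℕ) : ℝ) with hn_def
  have h1 : (transversalHoms c H.edgeTuples).card ≤
      ((transversalHoms c H.edgeTuples).filter
        (fun u => ∀ w, u w ∉ H.farVertices β (r w))).card +
      (Finset.univ.filter (fun u : W → V => ∃ w, u w ∈ H.farVertices β (r w))).card := by
    refine le_trans (Finset.card_le_card ?_) (Finset.card_union_le _ _)
    intro u hu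
    simp only [Finset.mem_union, Finset.mem_filter, Finset.mem_univ, true_and, hu]
    by_cases h : ∃ w, u w ∈ H.farVertices β (r w)
    · exact Or.inr h
    · exact Or.inl (not_exists.1 h)
  have h2 := card_filter_apply_mem_le (fun w : W => H.farVertices β (r w))
  have h3 : ((Finset.univ.filter (fun u : W → V => ∃ w, u w ∈ H.farVertices β (r w))).card : ℝ) *
      n ≤ (∑ w, ((H.farVertices β (r w)).card : ℝ)) * n ^ Fintype.card W := by
    rw [hn_def]; exact_mod_cast h2
  have h4 : ∑ w, ((H.farVertices β (r w)).card : ℝ) ≤ a / 2 * n := by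
    calc _ ≤ ∑ _w : W, ε * n := Finset.sum_le_sum fun w _ => hfar w
      _ = Fintype.card W * ε * n := by simp [mul_assoc]
      _ ≤ _ := by gcongr
  have h5 : ((Finset.univ.filter (fun u : W → V => ∃ w, u w ∈ H.farVertices β (r w))).card : ℝ)
      ≤ a / 2 * n ^ Fintype.card W := by
    refine le_of_mul_le_mul_right (h3.trans ?_) hnpos
    calc _ ≤ a / 2 * n * n ^ Fintype.card W := by gcongr
      _ = _ := by ring
  have h6 : ((transversalHoms c H.edgeTuples).card : ℝ) ≤
      ((transversalHoms c H.edgeTuples).filter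
        (fun u => ∀ w, u w ∉ H.farVertices β (r w))).card +
      (Finset.univ.filter (fun u : W → V => ∃ w, u w ∈ H.farVertices β (r w))).card := by
    exact_mod_cast h1
  linarith

/-- Once `u` is fixed, the switches for the different `w` are chosen independently, which gives the
factor `b ^ |W|`. Keeping the dummy entries makes the absorbers a product count. -/
theorem card_absorbers_ge {m : ℕ} {H : KGraph (m + 1) V} {c : W → Fin (m + 1)} {w₀ : W}
    {β a b : ℝ} (hb : 0 ≤ b) {r : W → V}
    (hnear : a * (Fintype.card V : ℝ) ^ Fintype.card W ≤
      ((transversalHoms c H.edgeTuples).filter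
        (fun u => ∀ w, u w ∉ H.farVertices β (r w))).card)
    (hswitch : ∀ w, ∀ x ∉ H.farVertices β (r w),
      b * (Fintype.card V : ℝ) ^ Fintype.card W ≤
        (Finset.univ.filter (fun g : W → V =>
          Function.update g w₀ x ∈ transversalHoms c H.edgeTuples ∧
          Function.update g w₀ (r w) ∈ transversalHoms c H.edgeTuples)).card) :
    a * b ^ Fintype.card W * (Fintype.card V : ℝ) ^ Fintype.card (Option W × W) ≤
      (H.absorbers c w₀ r).card := by
  set n : ℝ := ((Fintype.card V : ℕ) : ℝ) with hn_def
  set G := (transversalHoms c H.edgeTuples).filter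
        (fun u => ∀ w, u w ∉ H.farVertices β (r w)) with hG
  set Q : W → V → Finset (W → V) := fun w x => Finset.univ.filter (fun g : W → V =>
          Function.update g w₀ x ∈ transversalHoms c H.edgeTuples ∧
          Function.update g w₀ (r w) ∈ transversalHoms c H.edgeTuples) with hQ
  have h1 : (G.sigma (fun u => Fintype.piFinset (fun w => Q w (u w)))).card ≤
      (H.absorbers c w₀ r).card := by
    refine Finset.card_le_card_of_injOn
      (fun z j => j.1.elim (z.1 j.2) (fun w => z.2 w j.2)) ?_ ?_
    · rintro ⟨u, g⟩ h
      simp only [Finset.coe_sigma, Set.mem_sigma_iff, Finset.mem_coe, hG, Finset.mem_filter,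
        Fintype.mem_piFinset, hQ, Finset.mem_univ, true_and] at h
      simp only [absorbers, Finset.mem_coe, Finset.mem_filter, Finset.mem_univ, true_and,
        Option.elim]
      exact ⟨h.1.1, h.2⟩
    · rintro ⟨u, g⟩ - ⟨u', g'⟩ - heq
      have hu : u = u' := funext fun w => congrFun heq (none, w)
      have hg : g = g' := funext fun w => funext fun w' => congrFun heq (some w, w')
      rw [hu, hg]
  have h2 : (∑ u ∈ G, ∏ w, ((Q w (u w)).card : ℝ)) ≤ (H.absorbers c w₀ r).card := by
    rw [Finset.card_sigma] at h1
    simp only [Fintype.card_piFinset] at h1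
    exact_mod_cast h1
  refine le_trans ?_ h2
  have h3 : ∀ u ∈ G, (b * n ^ Fintype.card W) ^ Fintype.card W ≤
      ∏ w, ((Q w (u w)).card : ℝ) := by
    intro u hu
    rw [← Finset.card_univ (α := W), ← Finset.prod_const]
    refine Finset.prod_le_prod (fun _ _ => by positivity) fun w _ => ?_
    exact hswitch w (u w) ((Finset.mem_filter.1 hu).2 w)
  have h4 := Finset.card_nsmul_le_sum G _ _ h3
  rw [nsmul_eq_mul] at h4
  refine le_trans ?_ h4
  calc _ = a * n ^ Fintype.card W * (b * n ^ Fintype.card W) ^ Fintype.card W := by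
        rw [Fintype.card_prod, Fintype.card_option, mul_pow, ← pow_mul]; ring
    _ ≤ _ := by gcongr

end Absorbers

end KGraph

/-! ### From absorbers to a factor, and the choice of constants -/

namespace KGraph

theorem HasFactor.of_absorbers {W : Type u} {V : Type v} [Fintype W] [DecidableEq W] [Fintype V]
    [DecidableEq V] {k : ℕ} {F : KGraph k W} {H : KGraph k V} {c : W → Fin k}
    (hc : F.IsPartiteRealisation c) {w₀ : W} (𝓕 : Finset (Option W × W → V)) {l : ℝ}
    (hinj : ∀ T ∈ 𝓕, Function.Injective T) (hmem : ∀ T ∈ 𝓕, ∃ r, T ∈ H.absorbers c w₀ r)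
    (hdisj : (𝓕 : Set (Option W × W → V)).PairwiseDisjoint (fun T => Finset.univ.image T))
    (hmany : ∀ r, l + 1 ≤ (𝓕.filter (fun T => T ∈ H.absorbers c w₀ r)).card)
    (hcopy : ∀ U : Finset V, l ≤ U.card → ∃ φ : Copy F H, Finset.univ.map φ.toEmbedding ⊆ U)
    (hdvd : Fintype.card W ∣ Fintype.card V) : F.HasFactor H := by
  have hW : 0 < Fintype.card W := Fintype.card_pos_iff.2 ⟨w₀⟩
  have hdisj' : (𝓕 : Set (Option W × W → V)).PairwiseDisjoint (absorberVerts w₀) :=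
    fun T hT T' hT' hne => Disjoint.mono (absorberVerts_subset _ _) (absorberVerts_subset _ _)
      (hdisj hT hT' hne)
  set A := 𝓕.biUnion (absorberVerts w₀) with hA
  have hAtile : F.Tileable H A := tileable_biUnion _ _ (fun T hT =>
    (hmem T hT).elim fun r hr => tileable_absorberVerts hc hr (hinj T hT)) hdisj'
  obtain ⟨R, hRU, hRcard, hUtile⟩ := exists_tileable_sdiff hW hcopy (Finset.univ \ A)
  have hAR : Disjoint A R := (Finset.disjoint_of_subset_left hRU Finset.sdiff_disjoint).symm
  have hd : Disjoint (A ∪ R) ((Finset.univ \ A) \ R) := by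
    rw [Finset.disjoint_left]
    intro x hx
    simp only [Finset.mem_union, Finset.mem_sdiff, Finset.mem_univ, true_and] at hx ⊢
    tauto
  have huniv : (A ∪ R) ∪ ((Finset.univ \ A) \ R) = Finset.univ := by
    ext x
    simp only [Finset.mem_union, Finset.mem_sdiff, Finset.mem_univ, true_and]
    tauto
  -- `A` and the greedily tiled part have sizes divisible by `v(F)`, as has `V`, so `R` does too.
  have hdvdR : Fintype.card W ∣ R.card := by
    rw [← Finset.card_univ (α := V), ← huniv, Finset.card_union_of_disjoint hd,
      Finset.card_union_of_disjoint hAR] at hdvd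
    exact (Nat.dvd_add_right hAtile.dvd_card).1 ((Nat.dvd_add_left hUtile.dvd_card).1 hdvd)
  obtain ⟨q, hq⟩ := hdvdR
  have hAR' : F.Tileable H (A ∪ R) := by
    -- Intersecting with `𝓕` makes the injectivity of the chosen tuples available to the two tiling
    -- lemmas.
    refine tileable_union_of_absorbers (absorberVerts w₀)
      (fun r => (H.absorbers c w₀ r).filter (fun T => T ∈ 𝓕)) ?_ ?_ q R 𝓕 hq ?_ hdisj' ?_ ?_
    · intro r T hT
      rw [Finset.mem_filter] at hT
      exact tileable_absorberVerts hc hT.1 (hinj T hT.2)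
    · intro r hr T hT hdT
      rw [Finset.mem_filter] at hT
      exact tileable_absorberVerts_union hc hT.1 (hinj T hT.2) hr hdT
    · intro T hT
      obtain ⟨r, hr⟩ := hmem T hT
      exact ⟨r, Finset.mem_filter.2 ⟨hr, hT⟩⟩
    · intro T hT
      exact Finset.disjoint_of_subset_left (Finset.subset_biUnion_of_mem _ hT) hAR
    · intro r
      have h1 : 𝓕.filter (fun T => T ∈ (H.absorbers c w₀ r).filter (fun T => T ∈ 𝓕)) =
          𝓕.filter (fun T => T ∈ H.absorbers c w₀ r) := by
        refine Finset.filter_congr fun T hT => ?_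
        simp [hT]
      rw [h1]
      have h2 : q ≤ R.card := by rw [hq]; exact Nat.le_mul_of_pos_left _ hW
      have h3 : (q : ℝ) ≤ R.card := by exact_mod_cast h2
      have h4 : (q : ℝ) ≤ (𝓕.filter (fun T => T ∈ H.absorbers c w₀ r)).card := by
        linarith [hmany r]
      exact_mod_cast h4
  have := hAR'.union hUtile hd
  rw [huniv] at this
  exact this.hasFactor

/-- Requiring nearness halves `a`, and discarding non-injective tuples, which are few by `hn`,
halves the density again: hence the `4`. -/
theorem IsEdgeDense.card_injective_absorbers_ge {W : Type u} {V : Type v} [Fintype W]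
    [DecidableEq W] [Fintype V] [DecidableEq V] {m : ℕ} {H : KGraph (m + 1) V}
    {c : W → Fin (m + 1)} (hc : Function.Surjective c) {w₀ : W} (hw₀ : c w₀ = 0)
    {p μ α a b : ℝ} (h : H.IsEdgeDense p μ) (hp : 0 < p) (hα : 0 < α) (hV : 0 < Fintype.card V)
    (hdeg : ∀ x, α * (Fintype.card V : ℝ) ^ m ≤ (H.link x).card)
    (ha : a = (p / 2) ^ 2 ^ (Fintype.card W - (m + 1)))
    (hb : b = (p * (p * α / 2) / 2) ^ 2 ^ (Fintype.card W - (m + 1)))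
    (hμ₁ : μ ≤ p / 2) (hμ₂ : μ ≤ p * (p * α / 2) / 2)
    (hμ₃ : μ ≤ a / (2 * Fintype.card W) * (p * α / 2))
    (hn : (Fintype.card (Option W × W) : ℝ) ^ 2 ≤
      a * b ^ Fintype.card W / 4 * Fintype.card V) (r : W → V) :
    a * b ^ Fintype.card W / 4 * (Fintype.card V : ℝ) ^ Fintype.card (Option W × W) ≤
      ((H.absorbers c w₀ r).filter (fun T => T.Injective)).card := by
  have hnpos : (0 : ℝ) < Fintype.card V := by exact_mod_cast hV
  have : Nonempty V := Fintype.card_pos_iff.1 hV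
  have hW : 0 < Fintype.card W := Fintype.card_pos_iff.2 ⟨w₀⟩
  have hWpos : (0 : ℝ) < Fintype.card W := by exact_mod_cast hW
  have hWk : m + 1 ≤ Fintype.card W := by
    simpa using Fintype.card_le_of_surjective c hc
  have hapos : 0 < a := by rw [ha]; positivity
  have hbpos : 0 < b := by rw [hb]; positivity
  set n : ℝ := ((Fintype.card V : ℕ) : ℝ) with hn_def
  have hE : p / 2 * n ^ Fintype.card (Fin (m + 1)) ≤ H.edgeTuples.card := by
    have h1 := h.card_edgeTuplesOn_ge Finset.univ Finset.univ
    have h2 : ((H.edgeTuplesOn Finset.univ Finset.univ).card : ℝ) ≤ H.edgeTuples.card := by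
      exact_mod_cast Finset.card_le_card (Finset.filter_subset _ _)
    rw [Finset.card_univ, Finset.card_univ, Fintype.card_fun, Fintype.card_fin] at h1
    push_cast at h1
    rw [← hn_def] at h1
    rw [Fintype.card_fin]
    have h3 : μ * n ^ (m + 1) ≤ p / 2 * n ^ (m + 1) := by gcongr
    have h4 : p * n * n ^ m = p * n ^ (m + 1) := by ring
    linarith
  have hhom := card_transversalHoms_ge H.edgeTuples (by positivity) hE
    (Fintype.card W - (m + 1)) c hc (by rw [Fintype.card_fin]; omega)
  rw [← ha] at hhom
  have hnear := card_homs_near_ge (r := r) (β := p * α / 2) hV hhom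
    (ε := a / (2 * Fintype.card W))
    (fun w => h.card_farVertices_le hp hα hV (hdeg (r w)) hμ₃)
    (by apply le_of_eq; field_simp)
  have habs := card_absorbers_ge (w₀ := w₀) hbpos.le hnear (fun w x hx => by
    rw [hb]
    exact h.card_switches_ge hc hw₀ hp (by positivity) hμ₂ hV hx)
  have hsplit : (H.absorbers c w₀ r).card ≤
      ((H.absorbers c w₀ r).filter (fun T => T.Injective)).card +
      (Finset.univ.filter (fun T : Option W × W → V => ¬ T.Injective)).card := by
    refine le_trans (Finset.card_le_card ?_) (Finset.card_union_le _ _)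
    intro T hT
    simp only [Finset.mem_union, Finset.mem_filter, Finset.mem_univ, true_and, hT]
    exact em _
  have hsplit' : ((H.absorbers c w₀ r).card : ℝ) ≤
      ((H.absorbers c w₀ r).filter (fun T => T.Injective)).card +
      (Finset.univ.filter (fun T : Option W × W → V => ¬ T.Injective)).card := by
    exact_mod_cast hsplit
  have hbad : ((Finset.univ.filter (fun T : Option W × W → V => ¬ T.Injective)).card : ℝ) * n ≤
      (Fintype.card (Option W × W) : ℝ) ^ 2 * n ^ Fintype.card (Option W × W) := by
    rw [hn_def]
    exact_mod_cast card_filter_not_injective_le (Option W × W) V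
  have hbad' : ((Finset.univ.filter (fun T : Option W × W → V => ¬ T.Injective)).card : ℝ) ≤
      a * b ^ Fintype.card W / 4 * n ^ Fintype.card (Option W × W) := by
    refine le_of_mul_le_mul_right (hbad.trans ?_) hnpos
    calc _ ≤ a * b ^ Fintype.card W / 4 * n * n ^ Fintype.card (Option W × W) := by gcongr
      _ = _ := by ring
  have : a / 2 * b ^ Fintype.card W * n ^ Fintype.card (Option W × W) =
      a * b ^ Fintype.card W / 4 * n ^ Fintype.card (Option W × W) +
      a * b ^ Fintype.card W / 4 * n ^ Fintype.card (Option W × W) := by ring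
  linarith

end KGraph

/-- Take logarithms, using `exp (-1) ≤ 1 / 2` and `1 - x ≤ exp (-x)`: this gives `Z ≥ (β / 4) * N -
f * log n`, and `hlog` says that half of the main term survives. The `- 1` in `hN` allows for a
floor. -/
theorem le_of_half_pow_le {Z N f : ℕ} {n β γ : ℝ} (hn : 0 < n) (hβ : 0 ≤ β)
    (hN : γ * n - 1 ≤ N) (h1 : 0 ≤ 1 - β / 4)
    (hlog : f * Real.log n + β / 4 ≤ β * γ / 8 * n)
    (h : (1 / 2 : ℝ) ^ Z ≤ n ^ f * (1 - β / 4) ^ N) : β * γ / 8 * n ≤ Z := by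
  have h2 : Real.exp (-Z) ≤ (1 / 2 : ℝ) ^ Z := by
    rw [show (-Z : ℝ) = Z * (-1) by ring, Real.exp_nat_mul]
    refine pow_le_pow_left₀ (Real.exp_pos _).le ?_ _
    rw [Real.exp_neg, one_div]
    exact inv_anti₀ two_pos (by linarith [Real.add_one_le_exp 1])
  have h3 : (1 - β / 4) ^ N ≤ Real.exp (N * (-(β / 4))) := by
    rw [Real.exp_nat_mul]
    exact pow_le_pow_left₀ h1 (by linarith [Real.add_one_le_exp (-(β / 4))]) _
  have h4 : n ^ f = Real.exp (f * Real.log n) := by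
    rw [Real.exp_nat_mul, Real.exp_log hn]
  have h5 : Real.exp (-Z) ≤ Real.exp (f * Real.log n + N * (-(β / 4))) := by
    rw [Real.exp_add, ← h4]
    exact (h2.trans h).trans (by gcongr)
  have h6 := Real.exp_le_exp.1 h5
  nlinarith [mul_le_mul_of_nonneg_left hN hβ]

theorem eventually_large (f : ℕ) (A B C D x y z w : ℝ) (hx : 0 < x) (hy : 0 < y) (hz : 0 < z)
    (hw : 0 < w) : ∀ᶠ n : ℕ in Filter.atTop, 0 < n ∧ A ≤ x * n ∧ B < y * n ∧
      C ≤ z * n ∧ f * Real.log n + D ≤ w * n := by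
  have hlin : ∀ a K : ℝ, 0 < a → ∀ᶠ n : ℕ in Filter.atTop, K < a * n := fun a K ha =>
    (tendsto_natCast_atTop_atTop.const_mul_atTop ha).eventually_gt_atTop K
  have hlog : ∀ᶠ n : ℕ in Filter.atTop, (f : ℝ) * Real.log n ≤ w / 2 * n := by
    have h1 := (Real.isLittleO_log_id_atTop.comp_tendsto tendsto_natCast_atTop_atTop).bound
      (show 0 < w / (2 * (f + 1)) by positivity)
    filter_upwards [h1, Filter.eventually_gt_atTop 0] with n hn hn0
    simp only [Function.comp_apply, id, Real.norm_eq_abs, Nat.abs_cast] at hn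
    have hf : (f : ℝ) / (f + 1) ≤ 1 := by rw [div_le_one (by positivity)]; linarith
    calc (f : ℝ) * Real.log n ≤ f * (w / (2 * (f + 1)) * n) := by
          gcongr
          exact (le_abs_self _).trans hn
      _ = (f : ℝ) / (f + 1) * (w / 2 * n) := by field_simp
      _ ≤ 1 * (w / 2 * n) := by gcongr
      _ = _ := one_mul _
  filter_upwards [Filter.eventually_gt_atTop 0, hlin x A hx, hlin y B hy, hlin z C hz, hlog,
    hlin (w / 2) D (by positivity)] with n h0 h1 h2 h3 h4 h5
  exact ⟨h0, h1.le, h2, h3.le, by linarith⟩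

theorem theorem1p7 {k : ℕ} (hk : 2 ≤ k) {W : Type u} [Fintype W] (F : KGraph k W)
    (hF : F.IsKPartite) : KGraph.InFactorEdge.{u, v} F 1 := by
  classical
  -- Writing `k = m + 1` makes `Fin (k - 1)` reduce definitionally to `Fin m`.
  obtain ⟨m, rfl⟩ : ∃ m, k = m + 1 := ⟨k - 1, by omega⟩
  obtain ⟨c, hc⟩ := hF
  obtain ⟨w₀, hw₀⟩ := hc.1 0
  intro p α hp _ hα _
  have : Nonempty W := ⟨w₀⟩
  have hWpos : (0 : ℝ) < Fintype.card W := by exact_mod_cast Fintype.card_pos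
  have hJpos : (0 : ℝ) < Fintype.card (Option W × W) := by exact_mod_cast Fintype.card_pos
  set a : ℝ := (p / 2) ^ 2 ^ (Fintype.card W - (m + 1)) with ha
  set b : ℝ := (p * (p * α / 2) / 2) ^ 2 ^ (Fintype.card W - (m + 1)) with hb
  have hapos : 0 < a := by positivity
  have hbpos : 0 < b := by positivity
  -- `β` is the density of injective absorbers. About `γ * n` tuples are selected, with `γ` the
  -- largest value that the greedy selection permits. Each `r` then keeps `β * γ / 8 * n = 2 * ε *
  -- n` absorbers, enough for a remainder below `ε * n + 1`; `d` is the edge density guaranteed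
  -- inside sets of size `ε * n`.
  set β : ℝ := a * b ^ Fintype.card W / 4 with hβ
  have hβpos : 0 < β := by positivity
  set γ : ℝ := β / (2 * (Fintype.card (Option W × W) : ℝ) ^ 2) with hγ
  have hγpos : 0 < γ := by positivity
  set ε : ℝ := β * γ / 16 with hε
  have hεpos : 0 < ε := by positivity
  set d : ℝ := p * ε ^ (m + 1) / 2 with hd
  have hdpos : 0 < d := by positivity
  obtain ⟨n₀, hn₀⟩ := Filter.eventually_atTop.1 (eventually_large (Fintype.card W)
    ((Fintype.card (Option W × W) : ℝ) ^ 2) ((Fintype.card W : ℝ) ^ 2) 1 (β / 4) β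
    (d ^ 2 ^ (Fintype.card W - (m + 1))) ε (β * γ / 8) hβpos (by positivity) hεpos
    (by positivity))
  -- The four bounds on `μ` serve, in order, the count of homomorphisms, the switches, the far
  -- vertices and the copies inside linear-sized sets.
  refine ⟨n₀, min (min (p / 2) (p * (p * α / 2) / 2))
    (min (a / (2 * Fintype.card W) * (p * α / 2)) d), by positivity, ?_⟩
  intro V _ _ H hH hdeg hn hdvd
  obtain ⟨hV, hn1, hn2, hn3, hn4⟩ := hn₀ _ hn
  have hnpos : (0 : ℝ) < Fintype.card V := by exact_mod_cast hV
  have : Nonempty V := Fintype.card_pos_iff.1 hV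
  have hlink : ∀ x, α * (Fintype.card V : ℝ) ^ m ≤ (H.link x).card := by
    intro x
    have h1 : H.minDegree 1 ≤ (H.link x).card :=
      (H.minDegree_le_deg {x}).trans (H.deg_le_card_link x)
    have h2 : (H.minDegree 1 : ℝ) ≤ (H.link x).card := by exact_mod_cast h1
    rw [Nat.add_sub_cancel] at hdeg
    exact hdeg.trans h2
  have hcount := hH.card_injective_absorbers_ge hc.1 hw₀ hp hα hV hlink ha hb
    ((min_le_left _ _).trans (min_le_left _ _)) ((min_le_left _ _).trans (min_le_right _ _))
    ((min_le_right _ _).trans (min_le_left _ _)) hn1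
  obtain ⟨𝓕, -, hmem, hdisj, hpot⟩ := exists_disjoint_family
    (fun r => (H.absorbers c w₀ r).filter (fun T => T.Injective)) hβpos hcount hV
    ⌊γ * Fintype.card V⌋₊ (by
      calc _ ≤ (Fintype.card (Option W × W) : ℝ) ^ 2 * (γ * Fintype.card V) := by
            gcongr; exact Nat.floor_le (by positivity)
        _ = _ := by rw [hγ]; field_simp)
  have hβ1 : β ≤ 1 := by
    obtain ⟨r⟩ : Nonempty (W → V) := inferInstance
    have h1 : ((H.absorbers c w₀ r).filter (fun T => T.Injective)).card ≤
        Fintype.card V ^ Fintype.card (Option W × W) := by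
      rw [← Fintype.card_fun]
      exact Finset.card_le_univ _
    have h2 : (((H.absorbers c w₀ r).filter (fun T => T.Injective)).card : ℝ) ≤
        1 * (Fintype.card V : ℝ) ^ Fintype.card (Option W × W) := by
      rw [one_mul]; exact_mod_cast h1
    exact le_of_mul_le_mul_right ((hcount r).trans h2) (by positivity)
  refine KGraph.HasFactor.of_absorbers hc (w₀ := w₀) 𝓕 (l := ε * Fintype.card V) ?_ ?_ hdisj ?_
    ?_ hdvd
  · intro T hT
    obtain ⟨r, hr⟩ := hmem T hT
    exact (Finset.mem_filter.1 hr).2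
  · intro T hT
    obtain ⟨r, hr⟩ := hmem T hT
    exact ⟨r, (Finset.mem_filter.1 hr).1⟩
  · intro r
    -- One term is at most the whole potential, which started at the number `n ^ |W|` of tuples `r`.
    have h1 : (1 / 2 : ℝ) ^ (𝓕.filter (fun T => T ∈
        (H.absorbers c w₀ r).filter (fun T => T.Injective))).card ≤
        (Fintype.card V : ℝ) ^ Fintype.card W * (1 - β / 4) ^ ⌊γ * Fintype.card V⌋₊ := by
      refine le_trans ?_ (hpot.trans (le_of_eq ?_))
      · exact Finset.single_le_sum (f := fun r => (1 / 2 : ℝ) ^ (𝓕.filter (fun T => T ∈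
          (H.absorbers c w₀ r).filter (fun T => T.Injective))).card)
          (fun i _ => by positivity) (Finset.mem_univ r)
      · rw [Fintype.card_fun]; push_cast; rfl
    have h2 := le_of_half_pow_le hnpos hβpos.le (Nat.sub_one_lt_floor _).le (by linarith) hn4 h1
    have h3 : (𝓕.filter (fun T => T ∈
        (H.absorbers c w₀ r).filter (fun T => T.Injective))).card ≤
        (𝓕.filter (fun T => T ∈ H.absorbers c w₀ r)).card := by
      refine Finset.card_le_card fun T hT => ?_
      rw [Finset.mem_filter, Finset.mem_filter] at hT
      exact Finset.mem_filter.2 ⟨hT.1, hT.2.1⟩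
    have h4 : ((𝓕.filter (fun T => T ∈
        (H.absorbers c w₀ r).filter (fun T => T.Injective))).card : ℝ) ≤
        (𝓕.filter (fun T => T ∈ H.absorbers c w₀ r)).card := by exact_mod_cast h3
    have h5 : β * γ / 8 * (Fintype.card V : ℝ) = 2 * (ε * Fintype.card V) := by rw [hε]; ring
    linarith
  · intro U hU
    exact hH.exists_copy hc hp hεpos ((min_le_right _ _).trans (min_le_right _ _)) hV hn2 U hU
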